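/- Let $\mu_0$ be a probability measure on $\mathbb N_0=\{0,1,2,\dots\}$ such that $\mu_0(n)\ge\mu_0(n+1)$ for all $n\ge 0$. Then there is a probability measure $\mu$ on $\mathbb Z$ that is symmetric, i.e. $\mu(-k)=\mu(k)$ for all $k\in\mathbb Z$, and has the following property. Whenever $Y_1,Y_2,\dots$ are i.i.d. $\mathbb Z$-valued random variables with distribution $\mu$ and $S_n=Y_1+\dots+Y_n$, the first (non-strictly) ascending ladder epoch $\ell=\inf\{n>0 : S_n\ge 0\}$ is almost surely finite, and the first ladder height $S_{\ell}$ has distribution $\mu_0$. Moreover, $\mu$ can be taken to be $$\mu=\mu_0+\check\mu_\times-\mu_0*\check\mu_\times ,$$ where $\mu_\times$ is a probability measure on $\mathbb N=\{1,2,\dots\}$ with $\mu_0=\mu_0(0)\,\delta_0+(1-\mu_0(0))\,\mu_\times$, $\check\mu_\times(k)=\mu_\times(-k)$ is its reflection at $0$, and $*$ is convolution on $\mathbb Z$. (If $\mu_0=\delta_0$, then $\mu_\times$ is arbitrary and the formula gives $\mu=\delta_0$ for every choice.) -/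

import Mathlib

open MeasureTheory ProbabilityTheory

/-- A measure on `ℕ = {0, 1, 2, …}` regarded as a measure on `ℤ`. -/
noncomputable def Ladder.toInt (ν : Measure ℕ) : Measure ℤ :=
  ν.map (fun n : ℕ => (n : ℤ))

/-- The reflection at `0` of a measure on `ℤ`, `B ↦ σ (-B)`. -/
noncomputable def Ladder.reflection (σ : Measure ℤ) : Measure ℤ :=
  σ.map (fun k : ℤ => -k)

/-- A measure on `ℤ` is symmetric if it equals its reflection at `0`. -/
def Ladder.IsSymmetric (σ : Measure ℤ) : Prop :=
  Ladder.reflection σ = σ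

/-- The walk `S n = Y 0 + ⋯ + Y (n - 1)`, `S 0 = 0`, with increments `Y 0, Y 1, …`. -/
def Ladder.walk {Ω : Type*} (Y : ℕ → Ω → ℤ) (n : ℕ) (ω : Ω) : ℤ :=
  ∑ i ∈ Finset.range n, Y i ω

/-- The set of times `n > 0` with `S n ≥ 0 = S 0`. -/
def Ladder.ascendingTimes {Ω : Type*} (Y : ℕ → Ω → ℤ) (ω : Ω) : Set ℕ :=
  {n : ℕ | 0 < n ∧ 0 ≤ Ladder.walk Y n ω}

/-- The first (non-strictly) ascending ladder epoch `inf {n > 0 : S n ≥ 0}`. It is meaningful only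
where the set is non-empty, i.e. where the epoch is finite (the infimum of `∅` in `ℕ` is `0`). -/
noncomputable def Ladder.firstEpoch {Ω : Type*} (Y : ℕ → Ω → ℤ) (ω : Ω) : ℕ :=
  sInf (Ladder.ascendingTimes Y ω)

/-- The first (non-strictly) ascending ladder random variable: the position of the walk at the first
ascending ladder epoch. -/
noncomputable def Ladder.firstHeight {Ω : Type*} (Y : ℕ → Ω → ℤ) (ω : Ω) : ℤ :=
  Ladder.walk Y (Ladder.firstEpoch Y ω) ω

/-- `Y 0, Y 1, …` are independent random variables on `(Ω, P)`, each with distribution `μ`. -/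
structure Ladder.IsIID {Ω : Type*} [MeasurableSpace Ω] (P : Measure Ω) (Y : ℕ → Ω → ℤ)
    (μ : Measure ℤ) : Prop where
  indep : iIndepFun Y P
  law : ∀ n, HasLaw (Y n) μ P

/-! ### Reflection and convolution of measures on the integers. -/

namespace Ladder

/-! The formula for μ is a Wiener–Hopf factorization prescribed in advance. Let N be the ladder law,
X its part on the positive integers, X̌ the reflection of X, and M, P, B the averaging operators of
μ, N, X̌. Then μ + N ∗ X̌ = N + X̌ says I − M = (I − B)(I − P). That μ is a measure follows from
monotonicity of N (`conv_reflection_le`); symmetry follows on expanding N = aδ₀ + (1 − a)X, since X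
∗ X̌ is symmetric.

Finiteness of the epoch: the potential G = ∑_{n<m} Pⁿ 1_{<0} (`sojourn`) satisfies (I − P)G = 1_{<0}
− Pᵐ1_{<0}. By the factorization it is superharmonic for μ on the negatives, with a strict loss at
−m. So the walk killed on entering the nonnegatives leaves each fixed point. Its expected potential
stays at most 1 for every m, while G tends to m at −∞, so mass cannot escape to −∞ either: the
killed walk dies out (`tendsto_measure_negativeUpTo`).

Law of the height: take f equal to the indicator of y on the nonnegatives and X-harmonic on the
negatives. Then (I − P)f vanishes on the negatives, and B only looks strictly downwards, so Mf = Pf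
on the nonpositive integers. Optional stopping gives P(height = y) = Mf(0) = Pf(0) = N{y}
(`hasLaw_firstHeight`). -/

instance (ν : Measure ℕ) [IsProbabilityMeasure ν] : IsProbabilityMeasure (toInt ν) :=
  Measure.isProbabilityMeasure_map (Measurable.of_discrete.aemeasurable)

instance (σ : Measure ℤ) [IsProbabilityMeasure σ] : IsProbabilityMeasure (reflection σ) :=
  Measure.isProbabilityMeasure_map (Measurable.of_discrete.aemeasurable)

lemma reflection_apply (σ : Measure ℤ) (s : Set ℤ) : reflection σ s = σ (Neg.neg ⁻¹' s) :=
  Measure.map_apply Measurable.of_discrete (MeasurableSet.of_discrete)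

lemma reflection_singleton (σ : Measure ℤ) (k : ℤ) : reflection σ {k} = σ {-k} := by
  rw [reflection_apply]
  congr 1
  ext x
  simp

lemma reflection_reflection (σ : Measure ℤ) : reflection (reflection σ) = σ :=
  Measure.ext_of_singleton fun k => by simp [reflection_singleton]

lemma reflection_conv (σ τ : Measure ℤ) [SFinite σ] [SFinite τ] :
    reflection (σ.conv τ) = (reflection σ).conv (reflection τ) :=
  Measure.map_conv_addMonoidHom (-(AddMonoidHom.id ℤ)) Measurable.of_discrete

lemma conv_reflection_self (σ : Measure ℤ) [SFinite σ] [SFinite (reflection σ)] :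
    reflection (σ.conv (reflection σ)) = σ.conv (reflection σ) := by
  rw [reflection_conv, reflection_reflection, Measure.conv_comm]

lemma conv_reflection_singleton (N X : Measure ℤ) [SFinite N] [SFinite X]
    [SFinite (reflection X)] (k : ℤ) :
    (N.conv (reflection X)) {k} = ∫⁻ j, N {k + j} ∂X := by
  rw [Measure.conv_comm, ← lintegral_indicator_one (MeasurableSet.of_discrete),
    Measure.lintegral_conv Measurable.of_discrete, reflection,
    lintegral_map Measurable.of_discrete Measurable.of_discrete]
  refine lintegral_congr fun j => ?_
  rw [← lintegral_indicator_one (MeasurableSet.of_discrete)]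
  refine lintegral_congr fun y => ?_
  by_cases h : y = k + j
  · simp [h]
  · have : -j + y ≠ k := by omega
    simp [h, this]

lemma toInt_apply (ν : Measure ℕ) (s : Set ℤ) : toInt ν s = ν ((fun n : ℕ => (n : ℤ)) ⁻¹' s) :=
  Measure.map_apply Measurable.of_discrete (MeasurableSet.of_discrete)

lemma toInt_natCast (ν : Measure ℕ) (n : ℕ) : toInt ν {(n : ℤ)} = ν {n} := by
  rw [toInt_apply]
  congr 1
  ext x
  simp

lemma toInt_mixture (a b : ENNReal) (ν : Measure ℕ) :
    toInt (a • Measure.dirac 0 + b • ν) = a • Measure.dirac 0 + b • toInt ν := by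
  simp [toInt, Measure.map_add, Measurable.of_discrete, Measure.map_smul, Measure.map_dirac']

lemma toInt_pos_ae (ν : Measure ℕ) (h : ν {0} = 0) : ∀ᵐ k ∂(toInt ν), 0 < k := by
  rw [toInt, ae_map_iff Measurable.of_discrete.aemeasurable MeasurableSet.of_discrete, ae_iff]
  convert h using 2
  ext n
  simp

lemma toInt_nonneg_ae (ν : Measure ℕ) : ∀ᵐ k ∂(toInt ν), 0 ≤ k := by
  rw [toInt, ae_map_iff Measurable.of_discrete.aemeasurable MeasurableSet.of_discrete]
  simp

/-! ### The symmetric step law. -/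

section Step

variable {a : ENNReal} {N X : Measure ℤ}

/-- The ladder-height law `N` dominates the mixed term at nonnegative points. -/
lemma conv_reflection_le_of_nonneg [IsProbabilityMeasure N] [IsProbabilityMeasure X]
    (hX : ∀ᵐ k ∂X, 0 < k) (hmono : ∀ k j : ℤ, 0 ≤ k → k ≤ j → N {j} ≤ N {k})
    {k : ℤ} (hk : 0 ≤ k) : (N.conv (reflection X)) {k} ≤ N {k} := by
  rw [conv_reflection_singleton]
  calc ∫⁻ j, N {k + j} ∂X ≤ ∫⁻ _, N {k} ∂X :=
        lintegral_mono_ae (hX.mono fun j hj => hmono _ _ hk (by omega))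
    _ = N {k} := by simp

/-- Expanding N isolates X ∗ X̌, which is invariant under reflection; domination at negative points
and symmetry of μ both rest on this form. -/
lemma conv_reflection_eq [IsProbabilityMeasure X] (ha : a ≤ 1)
    (hN : N = a • Measure.dirac 0 + (1 - a) • X) :
    N.conv (reflection X) = a • reflection X + (1 - a) • X.conv (reflection X) := by
  have : a ≠ ⊤ := ne_top_of_le_ne_top ENNReal.one_ne_top ha
  have : IsFiniteMeasure (a • (Measure.dirac 0 : Measure ℤ)) := Measure.smul_finite _ this
  have : IsFiniteMeasure ((1 - a) • X) := Measure.smul_finite _ (by simp)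
  rw [hN, Measure.add_conv, Measure.conv_smul_left, Measure.conv_smul_left,
    Measure.dirac_zero_conv]

/-- At k ≥ 0 the term N suffices, by monotonicity. At k < 0 the term X̌ suffices: the bound at −k,
where N is (1 − a)X, transfers to k by symmetry of X ∗ X̌. -/
lemma conv_reflection_le [IsProbabilityMeasure N] [IsProbabilityMeasure X] (ha : a ≤ 1)
    (hN : N = a • Measure.dirac 0 + (1 - a) • X)
    (hX : ∀ᵐ k ∂X, 0 < k) (hmono : ∀ k j : ℤ, 0 ≤ k → k ≤ j → N {j} ≤ N {k}) :
    N.conv (reflection X) ≤ N + reflection X := by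
  have key : ∀ k, (N.conv (reflection X)) {k} ≤ (N + reflection X) {k} := by
    intro k
    rcases le_or_gt 0 k with hk | hk
    · exact (conv_reflection_le_of_nonneg hX hmono hk).trans (by simp)
    · have h1 := conv_reflection_le_of_nonneg hX hmono (k := -k) (by omega)
      have h2 : (X.conv (reflection X)) {-k} = (X.conv (reflection X)) {k} := by
        conv_rhs => rw [← conv_reflection_self, reflection_singleton]
      have h3 : N {-k} = (1 - a) * X {-k} := by
        have : (0 : ℤ) ≠ -k := by omega
        simp [hN, this]
      rw [conv_reflection_eq ha hN, h3] at h1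
      rw [conv_reflection_eq ha hN]
      simp only [Measure.coe_add, Measure.coe_smul, Pi.add_apply, Pi.smul_apply, smul_eq_mul,
        reflection_singleton, neg_neg, h2] at h1 ⊢
      have h4 : (1 - a) * (X.conv (reflection X)) {k} ≤ (1 - a) * X {-k} :=
        le_trans le_add_self h1
      calc a * X {-k} + (1 - a) * (X.conv (reflection X)) {k}
          ≤ a * X {-k} + (1 - a) * X {-k} := by gcongr
        _ = X {-k} := by rw [← add_mul, add_tsub_cancel_of_le ha, one_mul]
        _ ≤ _ := le_add_self
  intro s
  rw [← Measure.tsum_indicator_apply_singleton _ _ MeasurableSet.of_discrete,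
    ← Measure.tsum_indicator_apply_singleton _ _ MeasurableSet.of_discrete]
  exact ENNReal.tsum_le_tsum fun k => Set.indicator_le_indicator (key k)

/-- A probability measure `μ` with `μ + N ∗ X̌ = N + X̌` is symmetric. -/
lemma isSymmetric_of_add_conv_eq [IsProbabilityMeasure N] [IsProbabilityMeasure X] (ha : a ≤ 1)
    (hN : N = a • Measure.dirac 0 + (1 - a) • X) {μ : Measure ℤ}
    (hμ : μ + N.conv (reflection X) = N + reflection X) : IsSymmetric μ := by
  have key : ∀ k, μ {k} + (a * X {-k} + (1 - a) * (X.conv (reflection X)) {k}) =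
      a * (Measure.dirac 0 : Measure ℤ) {k} + (1 - a) * X {k} + X {-k} := by
    intro k
    have := congrArg (fun m : Measure ℤ => m {k}) hμ
    rw [conv_reflection_eq ha hN, hN] at this
    simpa only [Measure.coe_add, Measure.coe_smul, Pi.add_apply, Pi.smul_apply, smul_eq_mul,
        reflection_singleton] using this
  refine Measure.ext_of_singleton fun k => ?_
  rw [reflection_singleton]
  have h1 := key k
  have h2 := key (-k)
  have h3 : (X.conv (reflection X)) {-k} = (X.conv (reflection X)) {k} := by
    conv_rhs => rw [← conv_reflection_self, reflection_singleton]
  have h4 : (Measure.dirac 0 : Measure ℤ) {-k} = (Measure.dirac 0 : Measure ℤ) {k} := by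
    by_cases hk : k = 0
    · simp [hk]
    · simp [hk, Ne.symm hk, eq_comm]
  have split : ∀ j, X {j} = a * X {j} + (1 - a) * X {j} := fun j => by
    rw [← add_mul, add_tsub_cancel_of_le ha, one_mul]
  have hat : a ≠ ⊤ := ne_top_of_le_ne_top ENNReal.one_ne_top ha
  rw [h3, h4, neg_neg] at h2
  set c := (1 - a) * (X.conv (reflection X)) {k}
  have hct : c ≠ ⊤ := ENNReal.mul_ne_top (by simp) (measure_ne_top _ _)
  have hx1 : a * X {k} ≠ ⊤ := ENNReal.mul_ne_top hat (measure_ne_top _ _)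
  have hx2 : a * X {-k} ≠ ⊤ := ENNReal.mul_ne_top hat (measure_ne_top _ _)
  -- Extended nonnegative reals do not subtract, so finite terms are added to both sides and
  -- cancelled.
  refine (ENNReal.add_left_inj (ENNReal.add_ne_top.2
    ⟨ENNReal.add_ne_top.2 ⟨hx1, hx2⟩, hct⟩)).1 ?_
  calc μ {-k} + (a * X {k} + a * X {-k} + c)
      = (μ {-k} + (a * X {k} + c)) + a * X {-k} := by ring
    _ = (μ {k} + (a * X {-k} + c)) + a * X {k} := by
        rw [h1, h2]
        calc _ = a * (Measure.dirac 0 : Measure ℤ) {k} + X {k} +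
              (a * X {-k} + (1 - a) * X {-k}) := by ring
          _ = a * (Measure.dirac 0 : Measure ℤ) {k} + X {-k} +
              (a * X {k} + (1 - a) * X {k}) := by rw [← split, ← split]; ring
          _ = _ := by ring
    _ = _ := by ring

/-- The step law with prescribed ladder-height law. -/
lemma exists_isSymmetric_add_conv_eq [IsProbabilityMeasure N] [IsProbabilityMeasure X]
    (ha : a ≤ 1) (hN : N = a • Measure.dirac 0 + (1 - a) • X)
    (hX : ∀ᵐ k ∂X, 0 < k) (hmono : ∀ k j : ℤ, 0 ≤ k → k ≤ j → N {j} ≤ N {k}) :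
    ∃ μ : Measure ℤ, IsProbabilityMeasure μ ∧ IsSymmetric μ ∧
      μ + N.conv (reflection X) = N + reflection X := by
  -- The witness is the truncated difference of measures, which domination makes a true difference.
  have h := Measure.sub_add_cancel_of_le (conv_reflection_le ha hN hX hmono)
  refine ⟨_, ⟨?_⟩, isSymmetric_of_add_conv_eq ha hN h, h⟩
  have := congrArg (fun m : Measure ℤ => m Set.univ) h
  simp only [Measure.coe_add, Pi.add_apply, measure_univ] at this
  exact (ENNReal.add_left_inj ENNReal.one_ne_top).1 this

end Step

/-- Every law on `ℕ` is a mixture of `δ₀` and a law on `{1, 2, …}`. -/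
lemma exists_mixture (μ₀ : Measure ℕ) [IsProbabilityMeasure μ₀] :
    ∃ μx : Measure ℕ, IsProbabilityMeasure μx ∧ μx {0} = 0 ∧
      μ₀ = μ₀ {0} • Measure.dirac 0 + (1 - μ₀ {0}) • μx := by
  have hsplit : μ₀ = μ₀ {0} • Measure.dirac 0 + μ₀.restrict {0}ᶜ := by
    conv_lhs => rw [← Measure.restrict_add_restrict_compl (μ := μ₀) (s := {0})
      MeasurableSet.of_discrete, Measure.restrict_singleton]
  have hc : μ₀ {0}ᶜ = 1 - μ₀ {0} := prob_compl_eq_one_sub MeasurableSet.of_discrete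
  by_cases h : μ₀ {0}ᶜ = 0
  -- Here the second component has weight 0, so any law on the positive integers would do.
  · refine ⟨Measure.dirac 1, inferInstance, by simp, ?_⟩
    rw [← hc, h, zero_smul]
    rwa [Measure.restrict_eq_zero.2 h] at hsplit
  · refine ⟨ProbabilityTheory.cond μ₀ {0}ᶜ, cond_isProbabilityMeasure h, ?_, ?_⟩
    · rw [cond_apply MeasurableSet.of_discrete]
      simp
    · rw [ProbabilityTheory.cond, smul_smul, ← hc, ENNReal.mul_inv_cancel h (measure_ne_top _ _),
        one_smul]
      exact hsplit

lemma mixture_measure_eq {μ₀ μx μx' : Measure ℕ} (hx : μx {0} = 0) (hx' : μx' {0} = 0)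
    (h : μ₀ = μ₀ {0} • Measure.dirac 0 + (1 - μ₀ {0}) • μx)
    (h' : μ₀ = μ₀ {0} • Measure.dirac 0 + (1 - μ₀ {0}) • μx')
    (hlt : μ₀ {0} < 1) : μx = μx' := by
  refine Measure.ext_of_singleton fun n => ?_
  rcases Nat.eq_zero_or_pos n with rfl | hn
  · rw [hx, hx']
  · have e := congrArg (fun m : Measure ℕ => m {n}) (h.symm.trans h')
    have hd : (0 : ℕ) ≠ n := by omega
    simp only [Measure.coe_add, Measure.coe_smul, Pi.add_apply, Pi.smul_apply, smul_eq_mul] at e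
    rw [Measure.dirac_apply' _ MeasurableSet.of_discrete, Set.indicator_of_notMem (by simpa using hd),
      mul_zero, zero_add, zero_add] at e
    exact (ENNReal.mul_right_inj (tsub_pos_of_lt hlt).ne' (by simp)).1 e

end Ladder

/-! ### Averaging operators on bounded functions and the factorization. -/

namespace Ladder

/-- The mean of `f` after one step of law `σ` from `x`. -/
noncomputable def avg (σ : Measure ℤ) (f : ℤ → ℝ) (x : ℤ) : ℝ := ∫ y, f (x + y) ∂σ

/-- Uniform boundedness of a function on `ℤ`. -/
def Bdd (f : ℤ → ℝ) : Prop := ∃ C, ∀ x, |f x| ≤ C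

lemma Bdd.sub {f g : ℤ → ℝ} (hf : Bdd f) (hg : Bdd g) : Bdd (fun x => f x - g x) := by
  obtain ⟨C, hC⟩ := hf
  obtain ⟨D, hD⟩ := hg
  exact ⟨C + D, fun x => (abs_sub _ _).trans (add_le_add (hC x) (hD x))⟩

lemma Bdd.of_mem_Icc {f : ℤ → ℝ} (hf : ∀ x, f x ∈ Set.Icc (0 : ℝ) 1) : Bdd f :=
  ⟨1, fun x => abs_le.2 ⟨by linarith [(hf x).1], (hf x).2⟩⟩

lemma Bdd.integrable {f : ℤ → ℝ} (hf : Bdd f) (σ : Measure ℤ) [IsFiniteMeasure σ] :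
    Integrable f σ := by
  obtain ⟨C, hC⟩ := hf
  exact Integrable.of_bound Measurable.of_discrete.aestronglyMeasurable C
    (Filter.Eventually.of_forall hC)

lemma Bdd.comp {f : ℤ → ℝ} (hf : Bdd f) (g : ℤ → ℤ) : Bdd (fun x => f (g x)) := by
  obtain ⟨C, hC⟩ := hf
  exact ⟨C, fun x => hC _⟩

lemma Bdd.avg {f : ℤ → ℝ} (hf : Bdd f) (σ : Measure ℤ) [IsProbabilityMeasure σ] :
    Bdd (avg σ f) := by
  obtain ⟨C, hC⟩ := hf
  refine ⟨C, fun x => ?_⟩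
  simpa [Ladder.avg] using norm_integral_le_of_norm_le_const (μ := σ) (f := fun y => f (x + y))
    (Filter.Eventually.of_forall fun y => hC (x + y))

lemma avg_sub {f g : ℤ → ℝ} (hf : Bdd f) (hg : Bdd g) (σ : Measure ℤ) [IsFiniteMeasure σ]
    (x : ℤ) : avg σ (fun x => f x - g x) x = avg σ f x - avg σ g x :=
  integral_sub ((hf.comp _).integrable σ) ((hg.comp _).integrable σ)

lemma avg_mono {f g : ℤ → ℝ} (hf : Bdd f) (hg : Bdd g) {σ : Measure ℤ} [IsFiniteMeasure σ]
    {x : ℤ} (h : ∀ᵐ y ∂σ, f (x + y) ≤ g (x + y)) : avg σ f x ≤ avg σ g x :=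
  integral_mono_ae ((hf.comp _).integrable σ) ((hg.comp _).integrable σ) h

lemma avg_congr {f g : ℤ → ℝ} {σ : Measure ℤ}
    {x : ℤ} (h : ∀ᵐ y ∂σ, f (x + y) = g (x + y)) : avg σ f x = avg σ g x :=
  integral_congr_ae h

lemma avg_const (σ : Measure ℤ) [IsProbabilityMeasure σ] (c : ℝ) (x : ℤ) :
    avg σ (fun _ => c) x = c := by
  simp [avg]

lemma avg_mem_Icc {f : ℤ → ℝ} (hf : ∀ x, f x ∈ Set.Icc (0 : ℝ) 1) (σ : Measure ℤ)
    [IsProbabilityMeasure σ] (x : ℤ) : avg σ f x ∈ Set.Icc (0 : ℝ) 1 := by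
  refine ⟨integral_nonneg fun y => (hf _).1, ?_⟩
  rw [← avg_const σ 1 x]
  exact avg_mono (.of_mem_Icc hf) ⟨1, by simp⟩ (Filter.Eventually.of_forall fun y => (hf _).2)

lemma avg_antitone {f : ℤ → ℝ} (hb : Bdd f) (hf : Antitone f) (σ : Measure ℤ)
    [IsFiniteMeasure σ] : Antitone (avg σ f) := fun x y hxy =>
  integral_mono ((hb.comp _).integrable σ) ((hb.comp _).integrable σ)
    fun z => hf (by simpa using hxy)

lemma avg_add_measure {f : ℤ → ℝ} (hf : Bdd f) (σ τ : Measure ℤ) [IsFiniteMeasure σ]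
    [IsFiniteMeasure τ] (x : ℤ) : avg (σ + τ) f x = avg σ f x + avg τ f x :=
  integral_add_measure ((hf.comp _).integrable σ) ((hf.comp _).integrable τ)

lemma avg_conv {f : ℤ → ℝ} (hf : Bdd f) (σ τ : Measure ℤ) [IsFiniteMeasure σ]
    [IsFiniteMeasure τ] (x : ℤ) : avg (σ.conv τ) f x = avg σ (avg τ f) x := by
  rw [avg, integral_conv ((hf.comp _).integrable _)]
  simp only [avg, add_assoc]

lemma avg_comm {f : ℤ → ℝ} (hf : Bdd f) (σ τ : Measure ℤ) [IsFiniteMeasure σ]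
    [IsFiniteMeasure τ] (x : ℤ) : avg σ (avg τ f) x = avg τ (avg σ f) x := by
  rw [← avg_conv hf, ← avg_conv hf, Measure.conv_comm]

lemma avg_reflection (σ : Measure ℤ) (f : ℤ → ℝ) (x : ℤ) :
    avg (reflection σ) f x = ∫ y, f (x - y) ∂σ := by
  rw [avg, reflection, integral_map Measurable.of_discrete.aemeasurable
    Measurable.of_discrete.aestronglyMeasurable]
  simp only [sub_eq_add_neg]

/-- `(I - M) = (I - B) (I - P)` for `M`, `P`, `B` the averages over `μ`, `N`, `X̌`, when
`μ + N ∗ X̌ = N + X̌`. -/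
lemma avg_eq_of_add_conv_eq {μ N X : Measure ℤ} [IsProbabilityMeasure μ] [IsProbabilityMeasure N]
    [IsProbabilityMeasure X] (hμ : μ + N.conv (reflection X) = N + reflection X)
    {f : ℤ → ℝ} (hf : Bdd f) (x : ℤ) :
    avg μ f x = f x - (f x - avg N f x) +
      ∫ j, (f (x - j) - avg N f (x - j)) ∂X := by
  have h := congrArg (fun m : Measure ℤ => avg m f x) hμ
  simp only [avg_add_measure hf, avg_conv hf, avg_comm hf N] at h
  rw [← avg_reflection X (fun y => f y - avg N f y), avg_sub hf (hf.avg N)]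
  linarith

/-! ### The truncated potential of the walk with steps N. -/

section Renewal

variable (N : Measure ℤ)

/-- `survival N n x` is the probability that the sum of `n` steps of law `N`, started at `x`, is
negative. -/
noncomputable def survival : ℕ → ℤ → ℝ
  | 0 => fun x => if x < 0 then 1 else 0
  | n + 1 => avg N (survival n)

variable [IsProbabilityMeasure N]

lemma survival_mem_Icc (n : ℕ) (x : ℤ) : survival N n x ∈ Set.Icc (0 : ℝ) 1 := by
  induction n generalizing x with
  | zero => unfold survival; split_ifs <;> simp
  | succ n ih => exact avg_mem_Icc ih N x

lemma survival_bdd (n : ℕ) : Bdd (survival N n) := .of_mem_Icc (survival_mem_Icc N n)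

lemma survival_antitone (n : ℕ) : Antitone (survival N n) := by
  induction n with
  | zero =>
    intro x y h
    simp only [survival]
    split_ifs <;> first | omega | simp
  | succ n ih => exact avg_antitone (survival_bdd N n) ih N

variable {N}

lemma survival_eq_zero (hN : ∀ᵐ k ∂N, 0 ≤ k) (n : ℕ) {x : ℤ} (hx : 0 ≤ x) :
    survival N n x = 0 := by
  induction n generalizing x with
  | zero => simp [survival, hx]
  | succ n ih =>
    rw [survival, avg_congr (g := fun _ => 0) (hN.mono fun k hk => ih (by omega)), avg_const]

/-- A path of n unit steps reaches 0 from −n but only −1 from −n − 1. It has positive probability,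
and monotonicity keeps the other paths from cancelling its contribution. -/
lemma survival_drop_pos (h1 : N {1} ≠ 0) (n : ℕ) :
    0 < survival N n (-n - 1) - survival N n (-n) := by
  induction n with
  | zero => simp [survival]
  | succ n ih =>
    have hb := survival_bdd N n
    have e : survival N (n + 1) (-(n + 1 : ℕ) - 1) - survival N (n + 1) (-(n + 1 : ℕ)) =
        ∫ y, (survival N n (-(n + 1 : ℕ) - 1 + y) - survival N n (-(n + 1 : ℕ) + y)) ∂N :=
      (integral_sub ((hb.comp _).integrable N) ((hb.comp _).integrable N)).symm
    rw [e]
    have hi := ((hb.comp (fun y => -(n + 1 : ℕ) - 1 + y)).sub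
      (hb.comp (fun y => -(n + 1 : ℕ) + y))).integrable N
    have hn : ∀ y : ℤ, 0 ≤ survival N n (-(n + 1 : ℕ) - 1 + y) - survival N n (-(n + 1 : ℕ) + y) :=
      fun y => sub_nonneg.2 (survival_antitone N n (by omega))
    refine (integral_pos_iff_support_of_nonneg hn hi).2 (lt_of_lt_of_le (pos_iff_ne_zero.2 h1)
      (measure_mono ?_))
    rintro _ rfl
    have : (-(n + 1 : ℕ) - 1 + 1 : ℤ) = -n - 1 ∧ (-(n + 1 : ℕ) + 1 : ℤ) = -n := by
      push_cast; constructor <;> ring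
    simp only [Function.mem_support, this.1, this.2]
    exact ih.ne'

lemma survival_tendsto (n : ℕ) : Filter.Tendsto (survival N n) Filter.atBot (nhds 1) := by
  induction n with
  | zero =>
    refine tendsto_const_nhds.congr' ?_
    filter_upwards [Filter.eventually_lt_atBot 0] with x hx
    simp [survival, hx]
  | succ n ih =>
    have : Filter.Tendsto (fun x => ∫ y, survival N n (x + y) ∂N) Filter.atBot
        (nhds (∫ _, (1 : ℝ) ∂N)) := by
      refine tendsto_integral_filter_of_dominated_convergence (fun _ => 1)
        (Filter.Eventually.of_forall fun _ => Measurable.of_discrete.aestronglyMeasurable)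
        (Filter.Eventually.of_forall fun x => Filter.Eventually.of_forall fun y => ?_)
        (integrable_const _) (Filter.Eventually.of_forall fun y => ?_)
      · rw [Real.norm_of_nonneg (survival_mem_Icc N n _).1]
        exact (survival_mem_Icc N n _).2
      · exact ih.comp (Filter.tendsto_atBot_add_const_right _ y Filter.tendsto_id)
    rw [integral_const, probReal_univ, one_smul] at this
    exact this

variable (N) in
/-- The expected number of the times `0, …, m - 1` that the walk with steps of law `N` spends in the
negative integers. -/
noncomputable def sojourn (m : ℕ) (x : ℤ) : ℝ := ∑ n ∈ Finset.range m, survival N n x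

lemma sojourn_nonneg (m : ℕ) (x : ℤ) : 0 ≤ sojourn N m x :=
  Finset.sum_nonneg fun n _ => (survival_mem_Icc N n x).1

lemma sojourn_bdd (m : ℕ) : Bdd (sojourn N m) := by
  refine ⟨m, fun x => ?_⟩
  rw [abs_of_nonneg (sojourn_nonneg m x)]
  simpa [sojourn] using Finset.sum_le_card_nsmul (Finset.range m) (fun n => survival N n x) 1
    fun n _ => (survival_mem_Icc N n x).2

lemma sojourn_eq_zero (hN : ∀ᵐ k ∂N, 0 ≤ k) (m : ℕ) {x : ℤ} (hx : 0 ≤ x) : sojourn N m x = 0 :=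
  Finset.sum_eq_zero fun n _ => survival_eq_zero hN n hx

lemma sojourn_tendsto (m : ℕ) : Filter.Tendsto (sojourn N m) Filter.atBot (nhds m) := by
  have := tendsto_finsetSum (Finset.range m) fun n _ => survival_tendsto (N := N) n
  simp only [Finset.sum_const, Finset.card_range, nsmul_eq_mul, mul_one] at this
  exact this

/-- Averaging over N shifts the index of `survival` by one, so the sum telescopes. -/
lemma sojourn_sub_avg (m : ℕ) (x : ℤ) :
    sojourn N m x - avg N (sojourn N m) x = survival N 0 x - survival N m x := by
  have : avg N (sojourn N m) x = ∑ n ∈ Finset.range m, survival N (n + 1) x :=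
    integral_finsetSum _ fun n _ => ((survival_bdd N n).comp _).integrable N
  rw [this, sojourn, ← Finset.sum_sub_distrib, Finset.sum_range_sub']

end Renewal

/-! ### Harmonic functions for the strictly increasing walk with steps X. -/

section Hit

variable {N X : Measure ℤ}

/-- `hitApprox X y n x` is the probability that the walk with steps of law `X`, started at `x`, enters
the nonnegative integers within `n` steps and does so at `y`. -/
noncomputable def hitApprox (X : Measure ℤ) (y : ℤ) : ℕ → ℤ → ℝ
  | 0 => fun x => if 0 ≤ x ∧ x = y then 1 else 0
  | n + 1 => fun x => if 0 ≤ x then (if x = y then 1 else 0) else avg X (hitApprox X y n) x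

lemma hitApprox_mem_Icc [IsProbabilityMeasure X] (y : ℤ) (n : ℕ) (x : ℤ) : hitApprox X y n x ∈ Set.Icc (0 : ℝ) 1 := by
  induction n generalizing x with
  | zero => unfold hitApprox; split_ifs <;> simp
  | succ n ih =>
    unfold hitApprox
    split_ifs
    · simp
    · simp
    · exact avg_mem_Icc ih X x

lemma hitApprox_of_nonneg (y : ℤ) (n : ℕ) {x : ℤ} (hx : 0 ≤ x) :
    hitApprox X y n x = if x = y then 1 else 0 := by
  cases n <;> simp [hitApprox, hx]

lemma hitApprox_of_neg (y : ℤ) (n : ℕ) {x : ℤ} (hx : x < 0) :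
    hitApprox X y (n + 1) x = avg X (hitApprox X y n) x := by
  simp [hitApprox, not_le.2 hx]

/-- Each step of X is at least 1, so n steps from x ≥ −n already reach the nonnegatives. The
approximations are thus eventually constant at each point, and no limit is needed. -/
lemma hitApprox_succ (hX : ∀ᵐ k ∂X, 0 < k) (y : ℤ) (n : ℕ) {x : ℤ} (hx : -n ≤ x) :
    hitApprox X y (n + 1) x = hitApprox X y n x := by
  induction n generalizing x with
  | zero =>
    have : 0 ≤ x := by simpa using hx
    rw [hitApprox_of_nonneg _ _ this, hitApprox_of_nonneg _ _ this]
  | succ n ih =>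
    rcases le_or_gt 0 x with h | h
    · rw [hitApprox_of_nonneg _ _ h, hitApprox_of_nonneg _ _ h]
    · rw [hitApprox_of_neg _ _ h, hitApprox_of_neg _ _ h]
      refine avg_congr (hX.mono fun j hj => ih ?_)
      push_cast at hx
      omega

lemma hitApprox_eq (hX : ∀ᵐ k ∂X, 0 < k) (y : ℤ) {n m : ℕ} (hnm : n ≤ m) {x : ℤ} (hx : -n ≤ x) :
    hitApprox X y m x = hitApprox X y n x := by
  induction m, hnm using Nat.le_induction with
  | base => rfl
  | succ m hm ih => rw [hitApprox_succ hX y m (by omega), ih]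

/-- A function that is the indicator of `y` on the nonnegative integers and is harmonic for `X` on the
negative ones. -/
lemma exists_hit [IsProbabilityMeasure X] (hX : ∀ᵐ k ∂X, 0 < k) (y : ℤ) : ∃ f : ℤ → ℝ,
    (∀ x, f x ∈ Set.Icc (0 : ℝ) 1) ∧ (∀ x, 0 ≤ x → f x = if x = y then 1 else 0) ∧
      ∀ x < 0, f x = avg X f x := by
  refine ⟨fun x => hitApprox X y (-x).toNat x, fun x => hitApprox_mem_Icc _ _ _,
    fun x hx => hitApprox_of_nonneg _ _ hx, fun x hx => ?_⟩
  obtain ⟨n, hn⟩ : ∃ n : ℕ, (-x).toNat = n + 1 := ⟨(-x).toNat - 1, by omega⟩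
  simp only
  rw [hn, hitApprox_of_neg _ _ hx]
  exact avg_congr (hX.mono fun j hj => hitApprox_eq hX y (by omega) (by omega))

lemma avg_mixture [IsProbabilityMeasure X] {a : ENNReal} (ha : a ≤ 1) (hN : N = a • Measure.dirac 0 + (1 - a) • X)
    {f : ℤ → ℝ} (hf : Bdd f) (x : ℤ) :
    avg N f x = a.toReal * f x + (1 - a).toReal * avg X f x := by
  have : a ≠ ⊤ := ne_top_of_le_ne_top ENNReal.one_ne_top ha
  have : IsFiniteMeasure (a • (Measure.dirac 0 : Measure ℤ)) := Measure.smul_finite _ this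
  have : IsFiniteMeasure ((1 - a) • X) := Measure.smul_finite _ (by simp)
  rw [hN, avg_add_measure hf]
  simp [avg, integral_smul_measure]

/-- N is the lazy version of X: it stays put with probability a, which does not affect harmonicity.
-/
lemma avg_eq_self_of_harmonic [IsProbabilityMeasure X] {a : ENNReal} (ha : a ≤ 1)
    (hN : N = a • Measure.dirac 0 + (1 - a) • X) {f : ℤ → ℝ} (hf : Bdd f) {x : ℤ}
    (h : f x = avg X f x) : avg N f x = f x := by
  rw [avg_mixture ha hN hf, ← h, ← add_mul,
      ← ENNReal.toReal_add (ne_top_of_le_ne_top ENNReal.one_ne_top ha) (by simp),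
      add_tsub_cancel_of_le ha]
  simp

end Hit

/-! ### Transfer from N and X to the step law μ. -/

section Harmonic

variable {μ N X : Measure ℤ} [IsProbabilityMeasure μ] [IsProbabilityMeasure N]
    [IsProbabilityMeasure X]

/-- `sojourn` is superharmonic on the negative integers for the walk with step law `μ`. -/
lemma avg_sojourn_le (hX : ∀ᵐ k ∂X, 0 < k)
    (hμ : μ + N.conv (reflection X) = N + reflection X) (m : ℕ) {x : ℤ} (hx : x < 0) :
    avg μ (sojourn N m) x ≤
      sojourn N m x - (survival N m (x - 1) - survival N m x) := by
  rw [avg_eq_of_add_conv_eq hμ (sojourn_bdd m)]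
  simp only [sojourn_sub_avg]
  have h0 : ∀ y < 0, survival N 0 y = 1 := fun y hy => by simp [survival, hy]
  have : ∫ j, (survival N 0 (x - j) - survival N m (x - j)) ∂X ≤
      ∫ _, (1 - survival N m (x - 1)) ∂X := by
    refine integral_mono_ae ((((survival_bdd N 0).sub (survival_bdd N m)).comp _).integrable X)
      (integrable_const _) (hX.mono fun j hj => ?_)
    have := survival_antitone N m (show x - j ≤ x - 1 by omega)
    simp only [h0 _ (show x - j < 0 by omega)]
    linarith
  rw [h0 x hx]
  simp only [integral_const, probReal_univ, one_smul] at this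
  linarith

/-- At 0 every term of the factorization vanishes except an X-average of a function bounded by 1.
The point is that the bound does not depend on m. -/
lemma avg_sojourn_zero_le (hN : ∀ᵐ k ∂N, 0 ≤ k)
    (hμ : μ + N.conv (reflection X) = N + reflection X) (m : ℕ) :
    avg μ (sojourn N m) 0 ≤ 1 := by
  rw [avg_eq_of_add_conv_eq hμ (sojourn_bdd m)]
  simp only [sojourn_sub_avg]
  rw [sojourn_eq_zero hN m le_rfl, survival_eq_zero hN m le_rfl, survival_eq_zero hN 0 le_rfl]
  have : ∫ j, (survival N 0 (0 - j) - survival N m (0 - j)) ∂X ≤ ∫ _, (1 : ℝ) ∂X :=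
    integral_mono ((((survival_bdd N 0).sub (survival_bdd N m)).comp _).integrable X)
      (integrable_const _) fun j => by
        have h1 := (survival_mem_Icc N 0 (0 - j)).2
        have h2 := (survival_mem_Icc N m (0 - j)).1
        linarith
  simp only [integral_const, probReal_univ, one_smul] at this
  linarith

/-- A bounded function harmonic on the negative integers for `X` is so for `μ`. -/
lemma avg_eq_of_harmonic {a : ENNReal} (ha : a ≤ 1)
    (hN : N = a • Measure.dirac 0 + (1 - a) • X) (hX : ∀ᵐ k ∂X, 0 < k)
    (hμ : μ + N.conv (reflection X) = N + reflection X)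
    {f : ℤ → ℝ} (hf : Bdd f) (h : ∀ x < 0, f x = avg X f x) {x : ℤ} (hx : x ≤ 0) :
    avg μ f x = avg N f x := by
  have h0 : ∀ z < 0, f z - avg N f z = 0 := fun z hz =>
    sub_eq_zero.2 (avg_eq_self_of_harmonic ha hN hf (h z hz)).symm
  rw [avg_eq_of_add_conv_eq hμ hf, integral_congr_ae (g := fun _ => (0 : ℝ))
    (hX.mono fun j hj => h0 _ (by omega))]
  simp

end Harmonic

end Ladder

namespace Ladder

/-! ### The random walk, its ladder epoch and its Markov property. -/

section Walk

variable {Ω Ω' : Type*}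

/-- The event that the walk is negative at the times `1, …, n`. -/
def negativeUpTo (Y : ℕ → Ω → ℤ) (n : ℕ) : Set Ω :=
  {ω | ∀ k ∈ Finset.Icc 1 n, walk Y k ω < 0}

lemma walk_zero (Y : ℕ → Ω → ℤ) (ω : Ω) : walk Y 0 ω = 0 := by simp [walk]

lemma walk_succ (Y : ℕ → Ω → ℤ) (n : ℕ) (ω : Ω) : walk Y (n + 1) ω = walk Y n ω + Y n ω := by
  simp [walk, Finset.sum_range_succ]

lemma walk_congr {Y : ℕ → Ω → ℤ} {Y' : ℕ → Ω' → ℤ} {ω : Ω} {ω' : Ω'} {n : ℕ}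
    (h : ∀ i < n, Y i ω = Y' i ω') {k : ℕ} (hk : k ≤ n) : walk Y k ω = walk Y' k ω' :=
  Finset.sum_congr rfl fun i hi => h i ((Finset.mem_range.1 hi).trans_le hk)

lemma negativeUpTo_congr {Y : ℕ → Ω → ℤ} {Y' : ℕ → Ω' → ℤ} {ω : Ω} {ω' : Ω'} {n : ℕ}
    (h : ∀ i < n, Y i ω = Y' i ω') : ω ∈ negativeUpTo Y n ↔ ω' ∈ negativeUpTo Y' n :=
  forall₂_congr fun k hk => by rw [walk_congr h (Finset.mem_Icc.1 hk).2]

lemma negativeUpTo_zero (Y : ℕ → Ω → ℤ) : negativeUpTo Y 0 = Set.univ := by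
  simp [negativeUpTo]

lemma mem_negativeUpTo_succ {Y : ℕ → Ω → ℤ} {n : ℕ} {ω : Ω} :
    ω ∈ negativeUpTo Y (n + 1) ↔ ω ∈ negativeUpTo Y n ∧ walk Y (n + 1) ω < 0 := by
  simp only [negativeUpTo, Set.mem_ofPred_eq, Finset.mem_Icc]
  refine ⟨fun h => ⟨fun k hk => h k (by omega), h _ (by omega)⟩, fun h k hk => ?_⟩
  rcases eq_or_lt_of_le hk.2 with rfl | hlt
  · exact h.2
  · exact h.1 k (by omega)

lemma negativeUpTo_antitone (Y : ℕ → Ω → ℤ) : Antitone (negativeUpTo Y) :=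
  antitone_nat_of_succ_le fun _ _ h => (mem_negativeUpTo_succ.1 h).1

lemma walk_neg {Y : ℕ → Ω → ℤ} {n : ℕ} (hn : 1 ≤ n) {ω : Ω} (h : ω ∈ negativeUpTo Y n) :
    walk Y n ω < 0 := h n (Finset.mem_Icc.2 ⟨hn, le_rfl⟩)

lemma firstEpoch_eq {Y : ℕ → Ω → ℤ} {n : ℕ} {ω : Ω} (h : ω ∈ negativeUpTo Y n)
    (h' : ω ∉ negativeUpTo Y (n + 1)) : firstEpoch Y ω = n + 1 := by
  have hmem : n + 1 ∈ ascendingTimes Y ω :=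
    ⟨n.succ_pos, not_lt.1 fun hlt => h' (mem_negativeUpTo_succ.2 ⟨h, hlt⟩)⟩
  refine le_antisymm (Nat.sInf_le hmem) (le_csInf ⟨_, hmem⟩ fun k hk => ?_)
  by_contra hlt
  have := h k (Finset.mem_Icc.2 ⟨hk.1, by omega⟩)
  exact absurd hk.2 (not_le.2 this)

lemma firstHeight_nonneg {Y : ℕ → Ω → ℤ} {ω : Ω} (h : (ascendingTimes Y ω).Nonempty) :
    0 ≤ firstHeight Y ω := (Nat.sInf_mem h).2

lemma mem_negativeUpTo_of_empty {Y : ℕ → Ω → ℤ} {ω : Ω} (h : ¬ (ascendingTimes Y ω).Nonempty)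
    (n : ℕ) : ω ∈ negativeUpTo Y n := fun k hk =>
  not_le.1 fun hle => h ⟨k, (Finset.mem_Icc.1 hk).1, hle⟩

variable [MeasurableSpace Ω]

lemma measurable_walk {Y : ℕ → Ω → ℤ} (hY : ∀ n, Measurable (Y n)) (n : ℕ) :
    Measurable (walk Y n) :=
  Finset.measurable_fun_sum _ fun i _ => hY i

lemma measurableSet_negativeUpTo {Y : ℕ → Ω → ℤ} (hY : ∀ n, Measurable (Y n)) (n : ℕ) :
    MeasurableSet (negativeUpTo Y n) := by
  have : negativeUpTo Y n = ⋂ k ∈ Finset.Icc 1 n, walk Y k ⁻¹' Set.Iio 0 := by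
    ext
    simp [negativeUpTo]
  rw [this]
  exact Finset.measurableSet_biInter _ fun k _ => measurable_walk hY k MeasurableSet.of_discrete

lemma measurable_firstEpoch {Y : ℕ → Ω → ℤ} (hY : ∀ n, Measurable (Y n)) :
    Measurable (firstEpoch Y) := by
  have hmem : ∀ n, MeasurableSet {ω | n ∈ ascendingTimes Y ω} := fun n =>
    (MeasurableSet.const _).inter (measurable_walk hY n (MeasurableSet.of_discrete (s := Set.Ici 0)))
  refine measurable_to_countable' fun n => ?_
  -- The value 0 occurs exactly when there is no ascending time, because 0 itself is never one.
  rcases Nat.eq_zero_or_pos n with rfl | hn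
  · have : firstEpoch Y ⁻¹' {0} = ⋂ k, {ω | k ∈ ascendingTimes Y ω}ᶜ := by
      ext ω
      simp only [Set.mem_preimage, Set.mem_singleton_iff, firstEpoch, Nat.sInf_eq_zero,
        Set.mem_iInter, Set.mem_compl_iff, Set.mem_ofPred_eq, Set.eq_empty_iff_forall_notMem]
      exact ⟨fun h => h.resolve_left fun h0 => lt_irrefl _ h0.1, Or.inr⟩
    rw [this]
    exact MeasurableSet.iInter fun k => (hmem k).compl
  · have : firstEpoch Y ⁻¹' {n} =
        {ω | n ∈ ascendingTimes Y ω} ∩ ⋂ k ∈ Finset.range n, {ω | k ∈ ascendingTimes Y ω}ᶜ := by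
      ext ω
      simp only [Set.mem_preimage, Set.mem_singleton_iff, firstEpoch, Set.mem_inter_iff,
        Set.mem_ofPred_eq, Set.mem_iInter, Finset.mem_range, Set.mem_compl_iff]
      constructor
      · rintro rfl
        exact ⟨Nat.sInf_mem (Nat.nonempty_of_pos_sInf hn), fun k hk => Nat.notMem_of_lt_sInf hk⟩
      · exact fun h => le_antisymm (Nat.sInf_le h.1)
          (le_csInf ⟨_, h.1⟩ fun k hk => not_lt.1 fun hlt => h.2 k hlt hk)
    rw [this]
    exact (hmem n).inter (Finset.measurableSet_biInter _ fun k _ => (hmem k).compl)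

lemma measurable_firstHeight {Y : ℕ → Ω → ℤ} (hY : ∀ n, Measurable (Y n)) :
    Measurable (firstHeight Y) :=
  (measurable_from_prod_countable_right (f := fun p : ℕ × Ω => walk Y p.1 p.2)
    (measurable_walk hY)).comp ((measurable_firstEpoch hY).prodMk measurable_id)

variable {P : Measure Ω} [IsProbabilityMeasure P] {μ : Measure ℤ} {Y : ℕ → Ω → ℤ}

lemma Bdd.integrable_comp {f : ℤ → ℝ} (hf : Bdd f) {Z : Ω → ℤ} (hZ : Measurable Z) :
    Integrable (fun ω => f (Z ω)) P := by
  obtain ⟨C, hC⟩ := hf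
  exact Integrable.of_bound (Measurable.of_discrete.comp hZ).aestronglyMeasurable C
    (Filter.Eventually.of_forall fun ω => hC _)

/-- The Markov property of the walk killed on entering the nonnegative integers. -/
lemma setIntegral_walk_succ (hY : ∀ n, Measurable (Y n)) (h : IsIID P Y μ) {f : ℤ → ℝ}
    (hf : Bdd f) (n : ℕ) :
    ∫ ω in negativeUpTo Y n, f (walk Y (n + 1) ω) ∂P =
      ∫ ω in negativeUpTo Y n, avg μ f (walk Y n ω) ∂P := by
  -- The past up to time n is a function of T, which is independent of `Y n`; `Y'` rebuilds the walk
  -- from T, padded by 0. Fubini then integrates out the last step.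
  set T : Ω → (Finset.range n → ℤ) := fun ω i => Y i ω with hT
  set Y' : ℕ → (Finset.range n → ℤ) → ℤ :=
    fun i t => if hi : i ∈ Finset.range n then t ⟨i, hi⟩ else 0 with hY'
  have hTm : Measurable T := measurable_pi_lambda _ fun i => hY i
  have hY'm : ∀ i, Measurable (Y' i) := fun i => by
    by_cases hi : i ∈ Finset.range n
    · simp only [hY', hi, dite_true]
      exact measurable_pi_apply _
    · simp only [hY', hi, dite_false]
      exact measurable_const
  have hcongr : ∀ ω, ∀ i < n, Y i ω = Y' i (T ω) := fun ω i hi => by simp [hY', hT, hi]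
  have hμ : P.map (Y n) = μ := (h.law n).map_eq
  have : IsProbabilityMeasure μ := hμ ▸ Measure.isProbabilityMeasure_map (hY n).aemeasurable
  have : IsProbabilityMeasure (P.map T) := Measure.isProbabilityMeasure_map hTm.aemeasurable
  have hind : P.map (fun ω => (T ω, Y n ω)) = (P.map T).prod μ := by
    have h1 := (h.indep.indepFun_finset (Finset.range n) {n} (by simp) hY).comp
      (φ := id) (ψ := fun t : ({n} : Finset ℕ) → ℤ => t ⟨n, by simp⟩) measurable_id
      Measurable.of_discrete
    rw [← hμ]
    exact (indepFun_iff_map_prod_eq_prod_map_map hTm.aemeasurable (hY n).aemeasurable).1 h1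
  set A := negativeUpTo Y' n
  have hA : MeasurableSet A := measurableSet_negativeUpTo hY'm n
  set G : (Finset.range n → ℤ) × ℤ → ℝ :=
    (A ×ˢ Set.univ).indicator fun p => f (walk Y' n p.1 + p.2) with hG
  have hGm : Measurable G := by
    refine Measurable.indicator ?_ (hA.prod MeasurableSet.univ)
    exact Measurable.of_discrete.comp
      (((measurable_walk hY'm n).comp measurable_fst).add measurable_snd)
  have hGi : Integrable G ((P.map T).prod μ) := by
    obtain ⟨C, hC⟩ := hf
    refine Integrable.of_bound hGm.aestronglyMeasurable C (Filter.Eventually.of_forall fun p => ?_)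
    exact (norm_indicator_le_norm_self _ _).trans (hC _)
  have hmem : ∀ ω, ω ∈ negativeUpTo Y n ↔ T ω ∈ A := fun ω => negativeUpTo_congr (hcongr ω)
  have hw : ∀ ω, walk Y n ω = walk Y' n (T ω) := fun ω => walk_congr (hcongr ω) le_rfl
  rw [← integral_indicator (measurableSet_negativeUpTo hY n),
    ← integral_indicator (measurableSet_negativeUpTo hY n)]
  calc ∫ ω, (negativeUpTo Y n).indicator (fun ω => f (walk Y (n + 1) ω)) ω ∂P
      = ∫ ω, G (T ω, Y n ω) ∂P := by
        refine integral_congr_ae (Filter.Eventually.of_forall fun ω => ?_)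
        by_cases hω : T ω ∈ A <;> simp [hG, Set.indicator, hmem, hω, walk_succ, hw]
    _ = ∫ t, ∫ y, G (t, y) ∂μ ∂(P.map T) := by
        rw [← integral_prod _ hGi, ← hind, integral_map (hTm.prodMk (hY n)).aemeasurable
          hGm.aestronglyMeasurable]
    _ = ∫ ω, ∫ y, G (T ω, y) ∂μ ∂P :=
        integral_map hTm.aemeasurable
          (hGm.stronglyMeasurable.integral_prod_right' (ν := μ)).aestronglyMeasurable
    _ = _ := by
        refine integral_congr_ae (Filter.Eventually.of_forall fun ω => ?_)
        by_cases hω : T ω ∈ A <;> simp [hG, Set.indicator, hmem, hω, hw, avg]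

/-- Paths killed exactly at time n + 1 sit in the nonnegatives, where f vanishes, so they may be
included in the integral. -/
lemma setIntegral_killed_succ (hY : ∀ n, Measurable (Y n)) (h : IsIID P Y μ) {f : ℤ → ℝ}
    (hf : Bdd f) (hf0 : ∀ x, 0 ≤ x → f x = 0) (n : ℕ) :
    ∫ ω in negativeUpTo Y (n + 1), f (walk Y (n + 1) ω) ∂P =
      ∫ ω in negativeUpTo Y n, avg μ f (walk Y n ω) ∂P := by
  rw [← setIntegral_walk_succ hY h hf]
  refine (setIntegral_eq_of_subset_of_forall_sdiff_eq_zero (measurableSet_negativeUpTo hY n)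
    (negativeUpTo_antitone Y n.le_succ) fun ω hω => hf0 _ ?_).symm
  exact not_lt.1 fun hlt => hω.2 (mem_negativeUpTo_succ.2 ⟨hω.1, hlt⟩)

/-! ### Almost sure finiteness of the ladder epoch. -/

section Finite

variable {N X : Measure ℤ} [IsProbabilityMeasure μ] [IsProbabilityMeasure N]
    [IsProbabilityMeasure X]

lemma setIntegral_sojourn_le_one (hY : ∀ n, Measurable (Y n)) (h : IsIID P Y μ)
    (hN : ∀ᵐ k ∂N, 0 ≤ k) (hμ : μ + N.conv (reflection X) = N + reflection X) (m : ℕ) :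
    ∫ ω in negativeUpTo Y 1, sojourn N m (walk Y 1 ω) ∂P ≤ 1 := by
  rw [setIntegral_killed_succ hY h (sojourn_bdd m) (fun x hx => sojourn_eq_zero hN m hx),
    negativeUpTo_zero]
  simpa [walk_zero] using avg_sojourn_zero_le hN hμ m

/-- The potential loses mass in mean at every negative point; only the loss at −m is kept, where
`survival_drop_pos` makes it strict. The condition n ≥ 1 matters, since the walk starts at 0. -/
lemma setIntegral_sojourn_succ_le (hY : ∀ n, Measurable (Y n)) (h : IsIID P Y μ)
    (hN : ∀ᵐ k ∂N, 0 ≤ k) (hX : ∀ᵐ k ∂X, 0 < k)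
    (hμ : μ + N.conv (reflection X) = N + reflection X) (m : ℕ) {n : ℕ} (hn : 1 ≤ n) :
    (survival N m (-m - 1) - survival N m (-m)) *
        P.real (negativeUpTo Y n ∩ walk Y n ⁻¹' {-(m : ℤ)}) ≤
      ∫ ω in negativeUpTo Y n, sojourn N m (walk Y n ω) ∂P -
        ∫ ω in negativeUpTo Y (n + 1), sojourn N m (walk Y (n + 1) ω) ∂P := by
  have hS := measurable_walk hY n
  have hA := measurableSet_negativeUpTo hY n
  have hpre : MeasurableSet (walk Y n ⁻¹' {-(m : ℤ)}) := hS MeasurableSet.of_discrete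
  rw [setIntegral_killed_succ hY h (sojourn_bdd m) (fun x hx => sojourn_eq_zero hN m hx),
    ← integral_sub ((sojourn_bdd m).integrable_comp hS).integrableOn
      (((sojourn_bdd m).avg μ).integrable_comp hS).integrableOn]
  calc _ = ∫ ω in negativeUpTo Y n, (walk Y n ⁻¹' {-(m : ℤ)}).indicator
          (fun _ => survival N m (-m - 1) - survival N m (-m)) ω ∂P := by
        rw [setIntegral_indicator hpre, setIntegral_const, smul_eq_mul, mul_comm]
    _ ≤ _ := by
        refine setIntegral_mono_on ((integrable_const _).indicator hpre).integrableOn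
          (((sojourn_bdd m).sub ((sojourn_bdd m).avg μ)).integrable_comp hS).integrableOn hA
          fun ω hω => ?_
        have h1 := avg_sojourn_le hX hμ m (walk_neg hn hω)
        by_cases hm : walk Y n ω = -m
        · rw [Set.indicator_of_mem (by simpa using hm), ← hm]
          linarith
        · rw [Set.indicator_of_notMem (by simpa using hm)]
          have := survival_antitone N m (show walk Y n ω - 1 ≤ walk Y n ω by omega)
          linarith

lemma setIntegral_sojourn_antitone (hY : ∀ n, Measurable (Y n)) (h : IsIID P Y μ)
    (hN : ∀ᵐ k ∂N, 0 ≤ k) (hX : ∀ᵐ k ∂X, 0 < k)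
    (hμ : μ + N.conv (reflection X) = N + reflection X) (m : ℕ) :
    Antitone fun n => ∫ ω in negativeUpTo Y (n + 1), sojourn N m (walk Y (n + 1) ω) ∂P := by
  refine antitone_nat_of_succ_le fun n => sub_nonneg.1 (le_trans ?_
    (setIntegral_sojourn_succ_le hY h hN hX hμ m (Nat.le_add_left 1 n)))
  exact mul_nonneg (sub_nonneg.2 (survival_antitone N m (by omega))) measureReal_nonneg

/-- The killed walk leaves every point of the negative integers. -/
lemma tendsto_measure_walk_eq (hY : ∀ n, Measurable (Y n)) (h : IsIID P Y μ)
    (hN : ∀ᵐ k ∂N, 0 ≤ k) (hX : ∀ᵐ k ∂X, 0 < k)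
    (hμ : μ + N.conv (reflection X) = N + reflection X) (h1 : N {1} ≠ 0) (m : ℕ) :
    Filter.Tendsto (fun n => P.real (negativeUpTo Y (n + 1) ∩ walk Y (n + 1) ⁻¹' {-(m : ℤ)}))
      Filter.atTop (nhds 0) := by
  -- A decreasing sequence bounded below converges, so its successive differences, which control the
  -- probability of sitting at −m, tend to 0.
  set d := fun n => ∫ ω in negativeUpTo Y (n + 1), sojourn N m (walk Y (n + 1) ω) ∂P with hd
  have hd0 : BddBelow (Set.range d) := ⟨0, by
    rintro _ ⟨n, rfl⟩
    exact integral_nonneg fun ω => sojourn_nonneg m _⟩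
  have hlim := tendsto_atTop_ciInf (setIntegral_sojourn_antitone hY h hN hX hμ m) hd0
  have hdiff : Filter.Tendsto (fun n => (d n - d (n + 1)) /
      (survival N m (-m - 1) - survival N m (-m))) Filter.atTop (nhds 0) := by
    have := (hlim.sub (hlim.comp (Filter.tendsto_add_atTop_nat 1))).div_const
      (survival N m (-m - 1) - survival N m (-m))
    rw [sub_self, zero_div] at this
    exact this
  refine squeeze_zero (fun n => measureReal_nonneg) (fun n => ?_) hdiff
  rw [le_div_iff₀ (survival_drop_pos h1 m), mul_comm]
  exact setIntegral_sojourn_succ_le hY h hN hX hμ m (Nat.le_add_left 1 n)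

lemma tendsto_measure_negativeUpTo (hY : ∀ n, Measurable (Y n)) (h : IsIID P Y μ)
    (hN : ∀ᵐ k ∂N, 0 ≤ k) (hX : ∀ᵐ k ∂X, 0 < k)
    (hμ : μ + N.conv (reflection X) = N + reflection X) (h1 : N {1} ≠ 0) :
    Filter.Tendsto (fun n => P.real (negativeUpTo Y n)) Filter.atTop (nhds 0) := by
  have hanti : Antitone fun n => P.real (negativeUpTo Y n) := fun i j hij =>
    measureReal_mono (negativeUpTo_antitone Y hij)
  have hlim := tendsto_atTop_ciInf hanti ⟨0, by
    rintro _ ⟨n, rfl⟩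
    exact measureReal_nonneg⟩
  set L := ⨅ n, P.real (negativeUpTo Y n)
  have hL0 : 0 ≤ L := ge_of_tendsto' hlim fun n => measureReal_nonneg
  have hL : ∀ m : ℕ, L ≤ 2 / (m + 1 : ℕ) := fun m => by
    have hm : (0 : ℝ) < (m + 1 : ℕ) := by positivity
    -- Below −K the potential exceeds half its limit m + 1. As its mean is at most 1, Markov's
    -- inequality bounds the mass there by 2 / (m + 1); the finitely many points −K, …, −1 carry
    -- vanishing mass.
    obtain ⟨K, hK⟩ : ∃ K : ℕ, ∀ x : ℤ, x < -K → ((m + 1 : ℕ) : ℝ) / 2 ≤ sojourn N (m + 1) x := by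
      obtain ⟨b, hb⟩ := Filter.eventually_atBot.1
        ((sojourn_tendsto (N := N) (m + 1)).eventually (eventually_ge_nhds (half_lt_self hm)))
      exact ⟨b.natAbs, fun x hx => hb x (by omega)⟩
    have hsum : Filter.Tendsto (fun n => ∑ j ∈ Finset.Icc 1 K,
        P.real (negativeUpTo Y (n + 1) ∩ walk Y (n + 1) ⁻¹' {-(j : ℤ)}) + 2 / (m + 1 : ℕ))
        Filter.atTop (nhds (2 / (m + 1 : ℕ))) := by
      have := (tendsto_finsetSum (Finset.Icc 1 K) fun j _ =>
        tendsto_measure_walk_eq hY h hN hX hμ h1 j).add_const ((2 : ℝ) / (m + 1 : ℕ))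
      rwa [Finset.sum_const_zero, zero_add] at this
    refine le_of_tendsto_of_tendsto' (hlim.comp (Filter.tendsto_add_atTop_nat 1)) hsum fun n => ?_
    have hS := measurable_walk hY (n + 1)
    have hA := measurableSet_negativeUpTo hY (n + 1)
    have hpre : ∀ x : ℤ, MeasurableSet (walk Y (n + 1) ⁻¹' {x}) :=
      fun x => hS MeasurableSet.of_discrete
    have hV := ((sojourn_bdd (N := N) (m + 1)).integrable_comp (P := P) hS).const_mul
      (2 / (m + 1 : ℕ) : ℝ)
    have hI : ∀ j ∈ Finset.Icc 1 K, Integrable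
        ((walk Y (n + 1) ⁻¹' {-(j : ℤ)}).indicator fun _ => (1 : ℝ))
        (P.restrict (negativeUpTo Y (n + 1))) :=
      fun j _ => (integrable_const _).indicator (hpre _)
    have hle : ∫ _ in negativeUpTo Y (n + 1), (1 : ℝ) ∂P ≤
        ∫ ω in negativeUpTo Y (n + 1), ((∑ j ∈ Finset.Icc 1 K,
          (walk Y (n + 1) ⁻¹' {-(j : ℤ)}).indicator (fun _ => (1 : ℝ)) ω) +
          2 / (m + 1 : ℕ) * sojourn N (m + 1) (walk Y (n + 1) ω)) ∂P := by
      refine setIntegral_mono_on (integrable_const _).integrableOn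
        ((integrable_finsetSum _ hI).add hV.integrableOn) hA fun ω hω => ?_
      have hneg := walk_neg (Nat.le_add_left 1 n) hω
      have hs : ∀ j ∈ Finset.Icc 1 K, 0 ≤
          (walk Y (n + 1) ⁻¹' {-(j : ℤ)}).indicator (fun _ => (1 : ℝ)) ω :=
        fun j _ => Set.indicator_nonneg (fun _ _ => zero_le_one) _
      rcases lt_or_ge (walk Y (n + 1) ω) (-K) with hlt | hge
      · have h2 := hK _ hlt
        have h3 : 1 ≤ 2 / ((m + 1 : ℕ) : ℝ) * sojourn N (m + 1) (walk Y (n + 1) ω) := by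
          calc (1 : ℝ) = 2 / ((m + 1 : ℕ) : ℝ) * (((m + 1 : ℕ) : ℝ) / 2) := by field_simp
            _ ≤ _ := by gcongr
        linarith [Finset.sum_nonneg hs]
      · have h2 := Finset.single_le_sum hs
          (Finset.mem_Icc.2 (⟨by omega, by omega⟩ :
            1 ≤ (walk Y (n + 1) ω).natAbs ∧ (walk Y (n + 1) ω).natAbs ≤ K))
        rw [Set.indicator_of_mem (show ω ∈ walk Y (n + 1) ⁻¹' {-((walk Y (n + 1) ω).natAbs : ℤ)} from
          show walk Y (n + 1) ω = -((walk Y (n + 1) ω).natAbs : ℤ) by omega)]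
          at h2
        have h3 : 0 ≤ 2 / ((m + 1 : ℕ) : ℝ) * sojourn N (m + 1) (walk Y (n + 1) ω) :=
          mul_nonneg (by positivity) (sojourn_nonneg _ _)
        linarith
    rw [integral_add (integrable_finsetSum _ hI) hV.integrableOn, integral_finsetSum _ hI,
      integral_const_mul] at hle
    have hd := (setIntegral_sojourn_antitone hY h hN hX hμ (m + 1) (Nat.zero_le n)).trans
      (setIntegral_sojourn_le_one hY h hN hμ (m + 1))
    have hd2 := mul_le_mul_of_nonneg_left hd (show (0 : ℝ) ≤ 2 / (m + 1 : ℕ) by positivity)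
    have hi : ∀ j : ℕ, ∫ ω in negativeUpTo Y (n + 1),
        (walk Y (n + 1) ⁻¹' {-(j : ℤ)}).indicator (fun _ => (1 : ℝ)) ω ∂P =
        P.real (negativeUpTo Y (n + 1) ∩ walk Y (n + 1) ⁻¹' {-(j : ℤ)}) := fun j => by
      rw [setIntegral_indicator (hpre _), setIntegral_const, smul_eq_mul, mul_one]
    simp only [hi, setIntegral_const, smul_eq_mul, mul_one] at hle hd2
    exact hle.trans (by gcongr)
  have hL' : L ≤ 0 := by
    refine ge_of_tendsto' (x := Filter.atTop) (f := fun m : ℕ => (2 : ℝ) / (m + 1 : ℕ)) ?_ hL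
    exact (tendsto_const_div_atTop_nhds_zero_nat (2 : ℝ)).comp (Filter.tendsto_add_atTop_nat 1)
  rwa [le_antisymm hL' hL0] at hlim

end Finite

/-! ### The law of the ladder height. -/

section Height

/-- Optional stopping at the first ladder epoch. -/
lemma integral_firstHeight_eq (hY : ∀ n, Measurable (Y n)) (h : IsIID P Y μ)
    (hfin : Filter.Tendsto (fun n => P.real (negativeUpTo Y n)) Filter.atTop (nhds 0))
    {f : ℤ → ℝ} (hf : Bdd f) (hharm : ∀ x < 0, avg μ f x = f x) :
    ∫ ω, f (firstHeight Y ω) ∂P = avg μ f 0 := by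
  have hH := hf.integrable_comp (P := P) (measurable_firstHeight hY)
  have hA := measurableSet_negativeUpTo hY
  have hS := fun n => hf.integrable_comp (P := P) (measurable_walk hY n)
  -- This is the mean of f along the walk stopped at the ladder epoch. It is followed from time 1
  -- on, because f need not be harmonic at 0.
  have hconst : ∀ n, ∫ ω in negativeUpTo Y (n + 1), f (walk Y (n + 1) ω) ∂P +
      ∫ ω in (negativeUpTo Y (n + 1))ᶜ, f (firstHeight Y ω) ∂P = avg μ f 0 := by
    have hstep : ∀ n, ∫ ω in negativeUpTo Y (n + 1), f (walk Y (n + 1) ω) ∂P +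
        ∫ ω in (negativeUpTo Y (n + 1))ᶜ, f (firstHeight Y ω) ∂P =
        ∫ ω in negativeUpTo Y n, avg μ f (walk Y n ω) ∂P +
        ∫ ω in (negativeUpTo Y n)ᶜ, f (firstHeight Y ω) ∂P := fun n => by
      rw [← setIntegral_walk_succ hY h hf]
      simp only [← integral_indicator (hA _), ← integral_indicator (hA _).compl]
      rw [← integral_add ((hS _).indicator (hA _)) (hH.indicator (hA _).compl),
        ← integral_add ((hS _).indicator (hA _)) (hH.indicator (hA _).compl)]
      refine integral_congr_ae (Filter.Eventually.of_forall fun ω => ?_)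
      by_cases h1 : ω ∈ negativeUpTo Y (n + 1)
      · have h2 := negativeUpTo_antitone Y n.le_succ h1
        simp [h1, h2]
      · by_cases h2 : ω ∈ negativeUpTo Y n
        · simp [h1, h2, firstHeight, firstEpoch_eq h2 h1]
        · simp [h1, h2]
    intro n
    induction n with
    | zero =>
      rw [hstep, negativeUpTo_zero]
      simp [walk_zero]
    | succ n ih =>
      rw [hstep, ← ih]
      congr 1
      exact setIntegral_congr_fun (hA _) fun ω hω => hharm _ (walk_neg (Nat.le_add_left 1 n) hω)
  obtain ⟨C, hC⟩ := hf
  have hbound : ∀ n, |∫ ω, f (firstHeight Y ω) ∂P - avg μ f 0| ≤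
      (C + C) * P.real (negativeUpTo Y (n + 1)) := fun n => by
    rw [← hconst n, ← integral_add_compl (hA (n + 1)) hH, add_sub_add_right_eq_sub,
      ← integral_sub hH.integrableOn (hS _).integrableOn]
    exact norm_setIntegral_le_of_norm_le_const (f := fun ω => f (firstHeight Y ω) -
      f (walk Y (n + 1) ω)) (measure_lt_top _ _)
      fun ω _ => (abs_sub _ _).trans (add_le_add (hC _) (hC _))
  have hlim := (hfin.comp (Filter.tendsto_add_atTop_nat 1)).const_mul (C + C)
  rw [mul_zero] at hlim
  exact sub_eq_zero.1 (abs_nonpos_iff.1 (ge_of_tendsto' hlim hbound))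

lemma ae_ascendingTimes_nonempty
    (hfin : Filter.Tendsto (fun n => P.real (negativeUpTo Y n)) Filter.atTop (nhds 0)) :
    ∀ᵐ ω ∂P, (ascendingTimes Y ω).Nonempty := by
  have : P.real {ω | ¬ (ascendingTimes Y ω).Nonempty} ≤ 0 :=
    ge_of_tendsto' hfin fun n => measureReal_mono fun ω hω => mem_negativeUpTo_of_empty hω n
  exact (measureReal_eq_zero_iff).1 (le_antisymm this measureReal_nonneg)

variable {N X : Measure ℤ} [IsProbabilityMeasure μ] [IsProbabilityMeasure N]
    [IsProbabilityMeasure X]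

lemma hasLaw_firstHeight {a : ENNReal} (ha : a ≤ 1)
    (hNX : N = a • Measure.dirac 0 + (1 - a) • X) (hN : ∀ᵐ k ∂N, 0 ≤ k) (hX : ∀ᵐ k ∂X, 0 < k)
    (hμ : μ + N.conv (reflection X) = N + reflection X)
    (hY : ∀ n, Measurable (Y n)) (h : IsIID P Y μ)
    (hfin : Filter.Tendsto (fun n => P.real (negativeUpTo Y n)) Filter.atTop (nhds 0)) :
    HasLaw (firstHeight Y) N P := by
  have hm := measurable_firstHeight hY
  have : IsProbabilityMeasure (P.map (firstHeight Y)) :=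
    Measure.isProbabilityMeasure_map hm.aemeasurable
  refine ⟨hm.aemeasurable, Measure.ext_of_measureReal_singleton fun y => ?_⟩
  obtain ⟨f, hf01, hfy, hharm⟩ := exists_hit hX y
  have hf := Bdd.of_mem_Icc hf01
  have hfy' : ∀ x, 0 ≤ x → f x = ({y} : Set ℤ).indicator 1 x := fun x hx => by
    rw [hfy x hx]
    simp [Set.indicator]
  have key := integral_firstHeight_eq hY h hfin hf fun x hx => by
    rw [avg_eq_of_harmonic ha hNX hX hμ hf hharm hx.le,
      avg_eq_self_of_harmonic ha hNX hf (hharm x hx)]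
  rw [avg_eq_of_harmonic ha hNX hX hμ hf hharm le_rfl,
    avg_congr (hN.mono fun k hk => hfy' _ (by omega)),
    integral_congr_ae ((ae_ascendingTimes_nonempty hfin).mono fun ω hω =>
      hfy' _ (firstHeight_nonneg hω)),
    ← integral_map hm.aemeasurable Measurable.of_discrete.aestronglyMeasurable] at key
  simp only [avg, zero_add] at key
  rwa [integral_indicator_one MeasurableSet.of_discrete,
    integral_indicator_one MeasurableSet.of_discrete] at key

end Height

end Walk

/-- `HasLaw` gives only almost everywhere measurability; passing to measurable versions changes the
walk on a null set. -/
lemma IsIID.exists_measurable {Ω : Type*} [MeasurableSpace Ω] {P : Measure Ω} {Y : ℕ → Ω → ℤ}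
    {μ : Measure ℤ} (h : IsIID P Y μ) :
    ∃ Y' : ℕ → Ω → ℤ, (∀ n, Measurable (Y' n)) ∧ IsIID P Y' μ ∧ ∀ᵐ ω ∂P, ∀ n, Y n ω = Y' n ω := by
  have hm := fun n => (h.law n).aemeasurable
  have he := fun n => (hm n).ae_eq_mk
  exact ⟨fun n => (hm n).mk (Y n), fun n => (hm n).measurable_mk,
    ⟨h.indep.congr he, fun n => (h.law n).congr (he n).symm⟩, ae_all_iff.2 he⟩

lemma walk_eq_of_forall_eq {Ω : Type*} {Y Y' : ℕ → Ω → ℤ} {ω : Ω} (h : ∀ n, Y n ω = Y' n ω)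
    (n : ℕ) : walk Y n ω = walk Y' n ω :=
  walk_congr (fun i _ => h i) le_rfl

end Ladder

/-! ### Assembly, with the degenerate case μ₀ = δ₀ treated apart. -/

open Ladder

theorem lemma5p5 (μ₀ : Measure ℕ) [IsProbabilityMeasure μ₀]
    (hmono : ∀ n : ℕ, μ₀ {n + 1} ≤ μ₀ {n}) :
    ∃ μ : Measure ℤ,
      IsProbabilityMeasure μ ∧
      Ladder.IsSymmetric μ ∧
      -- `μ = μ₀ + μ̌ₓ - μ₀ * μ̌ₓ`, where `μ₀ = μ₀(0) δ₀ + (1 - μ₀(0)) μₓ` with `μₓ` supported by `{1, 2, …}`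
      (∀ μx : Measure ℕ, IsProbabilityMeasure μx → μx {0} = 0 →
        μ₀ = μ₀ {0} • Measure.dirac 0 + (1 - μ₀ {0}) • μx →
        ∀ k : ℤ, μ.real {k} =
          (Ladder.toInt μ₀).real {k} + (Ladder.reflection (Ladder.toInt μx)).real {k}
            - (Measure.conv (Ladder.toInt μ₀) (Ladder.reflection (Ladder.toInt μx))).real {k}) ∧
      -- the first ladder epoch is almost surely finite and the first ladder height has law `μ₀`
      (∀ (Ω : Type*) [MeasurableSpace Ω] (P : Measure Ω) (Y : ℕ → Ω → ℤ),
        IsProbabilityMeasure P → Ladder.IsIID P Y μ →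
          (∀ᵐ ω ∂P, (Ladder.ascendingTimes Y ω).Nonempty) ∧
          HasLaw (Ladder.firstHeight Y) (Ladder.toInt μ₀) P) := by
  obtain ⟨μx, hμx, hx0, hmix⟩ := exists_mixture μ₀
  have ha : μ₀ {0} ≤ 1 := prob_le_one
  have hmix' : toInt μ₀ = μ₀ {0} • Measure.dirac 0 + (1 - μ₀ {0}) • toInt μx := by
    rw [← toInt_mixture, ← hmix]
  have hX := toInt_pos_ae μx hx0
  have hanti : Antitone fun n : ℕ => μ₀ {n} := antitone_nat_of_succ_le hmono
  obtain ⟨μ, hμp, hsymm, hμ⟩ := exists_isSymmetric_add_conv_eq ha hmix' hX fun k j hk hkj => by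
    lift k to ℕ using hk
    lift j to ℕ using by omega
    rw [toInt_natCast, toInt_natCast]
    exact hanti (by exact_mod_cast hkj)
  have hdirac : μ₀ {0} = 1 → toInt μ₀ = Measure.dirac 0 := fun h1 => by simp [hmix', h1]
  have hμdirac : μ₀ {0} = 1 → μ = Measure.dirac 0 := fun h1 => by
    rw [hdirac h1, Measure.dirac_zero_conv] at hμ
    refine Measure.ext_of_singleton fun k => ?_
    have := congrArg (fun m : Measure ℤ => m {k}) hμ
    simp only [Measure.coe_add, Pi.add_apply] at this
    exact (ENNReal.add_left_inj (measure_ne_top _ _)).1 this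
  refine ⟨μ, hμp, hsymm, fun νx hνx hν0 hν k => ?_, fun Ω _ P Y hP hiid => ?_⟩
  · have hμν : μ + (toInt μ₀).conv (reflection (toInt νx)) = toInt μ₀ + reflection (toInt νx) := by
      -- If μ₀ = δ₀, the component on the positive integers is arbitrary but cancels from the
      -- formula; otherwise it is unique.
      rcases ha.eq_or_lt with h1 | h1
      · rw [hμdirac h1, hdirac h1, Measure.dirac_zero_conv]
      · rwa [mixture_measure_eq hν0 hx0 hν hmix h1]
    have := congrArg (fun m : Measure ℤ => m.real {k}) hμν
    rw [measureReal_add_apply, measureReal_add_apply] at this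
    linarith
  · obtain ⟨Y', hY', hiid', hYY'⟩ := hiid.exists_measurable
    have hfin : Filter.Tendsto (fun n => P.real (negativeUpTo Y' n)) Filter.atTop (nhds 0) := by
      rcases ha.eq_or_lt with h1 | h1
      -- With μ = δ₀ the walk is at 0 at time 1, so it is almost surely not negative there.
      · have hz : P.real (negativeUpTo Y' 1) = 0 := by
          have : ∀ᵐ ω ∂P, Y' 0 ω = 0 := by
            rw [(hiid'.law 0).ae_iff (p := fun k => k = 0) Measurable.of_discrete, hμdirac h1]
            simp [ae_dirac_eq]
          refine (measureReal_eq_zero_iff).2 (measure_mono_null (fun ω hω => ?_) (ae_iff.1 this))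
          have := walk_neg le_rfl hω
          simp only [walk, Finset.sum_range_one] at this
          exact this.ne
        refine tendsto_const_nhds.congr' ?_
        filter_upwards [Filter.eventually_ge_atTop 1] with n hn
        exact (le_antisymm ((measureReal_mono (negativeUpTo_antitone Y' hn)).trans hz.le)
          measureReal_nonneg).symm
      · refine tendsto_measure_negativeUpTo hY' hiid' (toInt_nonneg_ae μ₀) hX hμ ?_
        -- If μ₀ had no mass at 1, monotonicity would leave all of it at 0.
        intro hz
        have hz' : μ₀ {1} = 0 := by rwa [← toInt_natCast μ₀ 1]
        have hc : μ₀ {0}ᶜ = 0 := (measure_null_iff_singleton (Set.to_countable _)).2 fun n hn =>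
          le_antisymm ((hanti (Nat.one_le_iff_ne_zero.2 hn)).trans hz'.le) bot_le
        exact h1.ne ((prob_compl_eq_zero_iff MeasurableSet.of_discrete).1 hc)
    refine ⟨?_, ?_⟩
    · filter_upwards [ae_ascendingTimes_nonempty hfin, hYY'] with ω hω he
      simpa only [ascendingTimes, walk_eq_of_forall_eq he] using hω
    · refine (hasLaw_firstHeight ha hmix' (toInt_nonneg_ae μ₀) hX hμ hY' hiid' hfin).congr ?_
      filter_upwards [hYY'] with ω he
      simp only [firstHeight, firstEpoch, ascendingTimes, walk_eq_of_forall_eq he]
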